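/- For a polynomial $f(z)=w_0(z-\alpha_1)\cdots(z-\alpha_n)\in\mathbb{C}[z]$ with $w_0\neq 0$, let $\mu(f)=|w_0|\prod_{i=1}^n\max\{1,|\alpha_i|\}$ be its Mahler measure, and put $\mu(0)=0$. For $d\geq 1$ let $$\mathcal{U}_d=\{(w_0,\dots,w_d)\in\mathbb{R}^{d+1} : \mu(w_0z^d+w_1z^{d-1}+\cdots+w_d)\leq 1\},$$ let $\operatorname{vol}(\mathcal{U}_d)$ be its $(d+1)$-dimensional Lebesgue measure, and for real $T$ let $\mathcal{M}(\leq d,T)$ be the number of polynomials in $\mathbb{Z}[z]$ (the zero polynomial included) of degree at most $d$ and Mahler measure at most $T$. Put $P(m)=\prod_{j=0}^m\binom{m}{j}$ and $A(d)=\sum_{k=0}^dP(k)P(d-k)$. Theorem. For every integer $d\geq 1$ and every real $T\geq 1$, $\operatorname{vol}(\mathcal{U}_d)$ and $\mathcal{M}(\leq d,T)$ are finite and $$\left|\mathcal{M}(\leq d,T)-\operatorname{vol}(\mathcal{U}_d)\,T^{d+1}\right|\leq\kappa_0(d)\,T^d,$$ where $$\kappa_0(d)=4^{d+1}A(d)\left(d\binom{d}{\lfloor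 d/2\rfloor}+1\right)^d\leq 40\sqrt[4]{2}\,\pi^{3/4}e^{-3}\cdot d^{-1/4}\cdot\left(4\sqrt{2}\,e^{3/2}\pi^{-3/2}\right)^d\cdot\left(2\sqrt{e}\right)^{d^2}\leq 5.59\cdot(15.01)^{d^2}.$$ -/

import Mathlib

namespace MahlerCount

noncomputable section

open Polynomial

/-- The real polynomial `w₀ z^d + w₁ z^(d-1) + ⋯ + w_d` with coefficient vector
`w = (w₀, …, w_d)`. -/
def polyOfVec (d : ℕ) (w : Fin (d + 1) → ℝ) : ℝ[X] :=
  ∑ i : Fin (d + 1), C (w i) * X ^ (d - (i : ℕ))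

/-- The Mahler measure `μ(w)` of the real polynomial with coefficient vector `w`. -/
def vecMahler (d : ℕ) (w : Fin (d + 1) → ℝ) : ℝ :=
  (polyOfVec d w).mapMahlerMeasure Complex.ofRealHom

/-- The unit star body `U_d ⊆ ℝ^(d+1)`: the real polynomials of degree at most `d` whose Mahler
measure is at most `1`. -/
def unitStarBody (d : ℕ) : Set (Fin (d + 1) → ℝ) :=
  {w | vecMahler d w ≤ 1}

/-- The integer polynomials (zero included) of degree at most `d` and Mahler measure at
most `T`. -/
def intPolys (d : ℕ) (T : ℝ) : Set ℤ[X] :=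
  {f | f.degree ≤ (d : WithBot ℕ) ∧ f.mapMahlerMeasure (Int.castRingHom ℂ) ≤ T}

/-- `P(d) = ∏_{j=0}^d C(d,j)`. -/
def binomProd (d : ℕ) : ℕ :=
  ∏ j ∈ Finset.range (d + 1), d.choose j

/-- `A(d) = ∑_{k=0}^d P(k) P(d-k)`. -/
def binomConv (d : ℕ) : ℕ :=
  ∑ k ∈ Finset.range (d + 1), binomProd k * binomProd (d - k)

/-- `κ₀(d) = 4^(d+1) A(d) (d C(d,⌊d/2⌋) + 1)^d`. -/
def kappaZero (d : ℕ) : ℝ :=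
  4 ^ (d + 1) * (binomConv d : ℝ) * ((d : ℝ) * (d.choose (d / 2) : ℝ) + 1) ^ d

end

end MahlerCount

namespace MahlerCount

open Polynomial MeasureTheory

/-! Compare lattice points with volume through unit cubes: the two counts differ by at most the
number of half-open integer cubes meeting both the body `μ ≤ T` and its complement. A cube is
connected and `μ` is continuous (`continuous_vecMahler`), so each such cube contains a point with `μ
= T`.

The surface `μ = T` has only `d` parameters. Sorting roots by modulus writes each of its points as
`± T g h`, where `g` is monic of degree `k` with roots in the closed unit disc, and `h` has degree
at most `d - k`, constant term 1 and no root in the open disc (`hasInnerOuter_of_natDegree_le`).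
Binomial coefficients bound the free coefficients of `g` and `h`, so these lie in boxes whose
volumes multiply to `2^d P(k) P(d-k)`. Cut the boxes into cubes of side `1/M` with `M = ⌈d
C(d,⌊d/2⌋) T⌉`. This gives `2^(d+1) A(d) M^d` labels, signs included, and points with equal label
differ by at most 1 in every coordinate. One label therefore reaches at most `2^(d+1)` unit cubes,
whence `κ₀(d) T^d`.

The explicit bounds on `κ₀` rest on log-convexity of `P`, which gives `A ≤ (5/2) P`, and on
Stirling's formula. -/

/-! ### The products `P(n)` and the convolution `A(n)` -/

theorem binomProd_pos (n : ℕ) : 0 < binomProd n :=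
  Finset.prod_pos fun _ hj => Nat.choose_pos (Nat.lt_succ_iff.mp (Finset.mem_range.mp hj))

theorem binomProd_zero : binomProd 0 = 1 := by simp [binomProd]

theorem binomProd_one : binomProd 1 = 1 := by simp [binomProd, Finset.prod_range_succ]

/-- Multiply `C(n,j) (n+1) = C(n+1,j) (n+1-j)` over `j ≤ n`. -/
theorem binomProd_succ_mul_factorial (n : ℕ) :
    binomProd (n + 1) * n.factorial = (n + 1) ^ n * binomProd n := by
  have hfac : ∏ j ∈ Finset.range (n + 1), (n + 1 - j) = (n + 1).factorial := by
    rw [← Finset.prod_range_add_one_eq_factorial,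
      ← Finset.prod_range_reflect (fun x => x + 1) (n + 1)]
    refine Finset.prod_congr rfl fun j hj => ?_
    have := Finset.mem_range.mp hj
    omega
  have h : binomProd n * (n + 1) ^ (n + 1) = binomProd (n + 1) * (n + 1).factorial := by
    have h1 : binomProd (n + 1) = ∏ j ∈ Finset.range (n + 1), (n + 1).choose j := by
      rw [binomProd, Finset.prod_range_succ, Nat.choose_self, mul_one]
    have h2 : ((n + 1) ^ (n + 1) : ℕ) = ∏ _j ∈ Finset.range (n + 1), (n + 1) := by simp
    rw [h1, ← hfac, h2, binomProd, ← Finset.prod_mul_distrib, ← Finset.prod_mul_distrib]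
    exact Finset.prod_congr rfl fun j _ => Nat.choose_mul_succ_eq n j
  rw [Nat.factorial_succ] at h
  apply Nat.eq_of_mul_eq_mul_left (Nat.succ_pos n)
  rw [Nat.succ_eq_add_one]
  linear_combination -h

/-- Log-convexity of `P`: consecutive ratios `(n+1)^n / n!` grow by the factor `((n+2)/(n+1))^(n+1)
≥ 1`. -/
theorem binomProd_ratio_mono (n : ℕ) :
    binomProd (n + 1) * binomProd (n + 1) ≤ binomProd (n + 2) * binomProd n := by
  have h1 := binomProd_succ_mul_factorial n
  have h2 := binomProd_succ_mul_factorial (n + 1)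
  have hpow : (n + 1) ^ (n + 1) ≤ (n + 1 + 1) ^ (n + 1) := Nat.pow_le_pow_left (by omega) _
  have hf : 0 < (n + 1).factorial * n.factorial := by positivity
  refine Nat.le_of_mul_le_mul_right ?_ hf
  calc binomProd (n + 1) * binomProd (n + 1) * ((n + 1).factorial * n.factorial)
      = binomProd (n + 1) * (binomProd (n + 1) * n.factorial) * ((n + 1) * n.factorial) := by
        rw [Nat.factorial_succ]; ring
    _ = (n + 1) ^ (n + 1) * (binomProd (n + 1) * binomProd n * n.factorial) := by
        rw [h1]; ring
    _ ≤ (n + 1 + 1) ^ (n + 1) * (binomProd (n + 1) * binomProd n * n.factorial) :=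
        Nat.mul_le_mul_right _ hpow
    _ = (binomProd (n + 2) * (n + 1).factorial) * (binomProd n * n.factorial) := by
        rw [h2]; ring
    _ = _ := by ring

theorem binomProd_succ_mul_le (i j : ℕ) :
    binomProd (i + 1) * binomProd (i + j) ≤ binomProd (i + j + 1) * binomProd i := by
  induction j with
  | zero => simp [mul_comm]
  | succ j ih =>
    have h := binomProd_ratio_mono (i + j)
    have hp := binomProd_pos (i + j)
    refine Nat.le_of_mul_le_mul_right ?_ hp
    calc binomProd (i + 1) * binomProd (i + j + 1) * binomProd (i + j)
        = (binomProd (i + 1) * binomProd (i + j)) * binomProd (i + j + 1) := by ring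
      _ ≤ (binomProd (i + j + 1) * binomProd i) * binomProd (i + j + 1) :=
          Nat.mul_le_mul_right _ ih
      _ = (binomProd (i + j + 1) * binomProd (i + j + 1)) * binomProd i := by ring
      _ ≤ (binomProd (i + j + 2) * binomProd (i + j)) * binomProd i := Nat.mul_le_mul_right _ h
      _ = _ := by ring_nf

/-- By log-convexity, spreading two indices apart at fixed sum increases the product; the extreme
pair contains `P(1) = 1`. -/
theorem binomProd_mul_le (i j : ℕ) :
    binomProd (i + 1) * binomProd (j + 1) ≤ binomProd (i + j + 1) := by
  induction i with
  | zero => simp [binomProd_one]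
  | succ i ih =>
    have h := binomProd_succ_mul_le (i + 1) j
    refine Nat.le_of_mul_le_mul_right ?_ (binomProd_pos (i + 1))
    calc binomProd (i + 1 + 1) * binomProd (j + 1) * binomProd (i + 1)
        = (binomProd (i + 1) * binomProd (j + 1)) * binomProd (i + 1 + 1) := by ring
      _ ≤ binomProd (i + j + 1) * binomProd (i + 1 + 1) := Nat.mul_le_mul_right _ ih
      _ = binomProd (i + 1 + 1) * binomProd (i + 1 + j) := by
          rw [show i + j + 1 = i + 1 + j by ring, mul_comm]
      _ ≤ _ := h

theorem two_mul_succ_pow_le (n : ℕ) : 2 * (n + 1) ^ (n + 1) ≤ (n + 2) ^ (n + 1) := by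
  have hpos : (0 : ℚ) ≤ 1 / (n + 1) := by positivity
  have h := one_add_mul_le_pow (R := ℚ) (a := 1 / (n + 1)) (by linarith) (n + 1)
  have h1 : (1 + 1 / ((n : ℚ) + 1)) = (n + 2) / (n + 1) := by field_simp; ring
  have h2 : (1 + ((n + 1 : ℕ) : ℚ) * (1 / ((n : ℚ) + 1))) = 2 := by
    push_cast
    field_simp
    norm_num
  rw [h1, h2, div_pow, le_div_iff₀ (by positivity)] at h
  exact_mod_cast h

theorem two_mul_self_mul_factorial_le (n : ℕ) : 2 * (n * n.factorial) ≤ (n + 1) ^ n := by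
  induction n with
  | zero => simp
  | succ n ih =>
    rcases Nat.eq_zero_or_pos n with rfl | hn
    · simp
    have hb := two_mul_succ_pow_le n
    refine Nat.le_of_mul_le_mul_left ?_ hn
    calc n * (2 * ((n + 1) * (n + 1).factorial))
        = (n + 1) ^ 2 * (2 * (n * n.factorial)) := by
          rw [Nat.factorial_succ]; ring
      _ ≤ (n + 1) ^ 2 * (n + 1) ^ n := Nat.mul_le_mul_left _ ih
      _ = (n + 1) * (n + 1) ^ (n + 1) := by ring
      _ ≤ (2 * n) * (n + 1) ^ (n + 1) := Nat.mul_le_mul_right _ (by omega)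
      _ = n * (2 * (n + 1) ^ (n + 1)) := by ring
      _ ≤ n * (n + 2) ^ (n + 1) := Nat.mul_le_mul_left _ hb

theorem two_mul_self_mul_binomProd_le (n : ℕ) :
    2 * (n * binomProd n) ≤ binomProd (n + 1) := by
  refine Nat.le_of_mul_le_mul_right ?_ n.factorial_pos
  rw [binomProd_succ_mul_factorial]
  calc 2 * (n * binomProd n) * n.factorial = 2 * (n * n.factorial) * binomProd n := by ring
    _ ≤ _ := Nat.mul_le_mul_right _ (two_mul_self_mul_factorial_le n)

/-- With `n = m + 1`, the two end terms each equal `P(n)`; the `m` inner terms are each at most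
`P(m)`, and `m P(m) ≤ P(n) / 2`. -/
theorem two_mul_binomConv_le (n : ℕ) (hn : 1 ≤ n) : 2 * binomConv n ≤ 5 * binomProd n := by
  obtain ⟨m, rfl⟩ : ∃ m, n = m + 1 := ⟨n - 1, by omega⟩
  have hmid : ∑ k ∈ Finset.range m, binomProd (k + 1) * binomProd (m + 1 - (k + 1))
      ≤ m * binomProd m := by
    calc _ ≤ ∑ k ∈ Finset.range m, binomProd m := by
          refine Finset.sum_le_sum fun k hk => ?_
          have hk := Finset.mem_range.mp hk
          have h := binomProd_mul_le k (m - 1 - k)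
          rwa [show m - 1 - k + 1 = m + 1 - (k + 1) by omega,
            show k + (m - 1 - k) + 1 = m by omega] at h
      _ = m * binomProd m := by simp
  have h := two_mul_self_mul_binomProd_le m
  rw [binomConv, Finset.sum_range_succ, Finset.sum_range_succ', Nat.sub_self, Nat.sub_zero,
    binomProd_zero]
  linarith

/-! ### Middle binomial coefficients -/

theorem centralBinom_sq_mul_le (m : ℕ) : m.centralBinom ^ 2 * (3 * m + 1) ≤ 16 ^ m := by
  induction m with
  | zero => simp
  | succ m ih =>
    have h := Nat.succ_mul_centralBinom_succ m
    refine Nat.le_of_mul_le_mul_left ?_ (show 0 < (m + 1) ^ 2 * (3 * m + 1) by positivity)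
    calc (m + 1) ^ 2 * (3 * m + 1) * ((m + 1).centralBinom ^ 2 * (3 * (m + 1) + 1))
        = ((m + 1) * (m + 1).centralBinom) ^ 2 * ((3 * m + 1) * (3 * m + 4)) := by ring
      _ = (m.centralBinom ^ 2 * (3 * m + 1)) * (4 * (2 * m + 1) ^ 2 * (3 * m + 4)) := by
          rw [h]; ring
      _ ≤ 16 ^ m * (16 * ((m + 1) ^ 2 * (3 * m + 1))) := by
          refine Nat.mul_le_mul ih ?_
          nlinarith
      _ = _ := by ring

theorem choose_half_sq_mul_le (n : ℕ) : (n.choose (n / 2)) ^ 2 * (3 * n + 2) ≤ 2 * 4 ^ n := by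
  obtain ⟨m, rfl | rfl⟩ := Nat.even_or_odd' n
  · have h := centralBinom_sq_mul_le m
    rw [Nat.mul_div_cancel_left m two_pos, ← Nat.centralBinom_eq_two_mul_choose, pow_mul]
    norm_num
    linarith
  · have h := centralBinom_sq_mul_le (m + 1)
    have h2 : (m + 1).centralBinom = 2 * (2 * m + 1).choose m := by
      rw [Nat.centralBinom_eq_two_mul_choose, show 2 * (m + 1) = 2 * m + 1 + 1 by ring,
        Nat.choose_succ_succ, ← Nat.choose_symm_half m]
      ring
    rw [h2] at h
    rw [show (2 * m + 1) / 2 = m by omega, pow_succ 4, pow_mul]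
    norm_num
    rw [pow_succ 16] at h
    nlinarith [sq_nonneg ((2 * m + 1).choose m)]

theorem mul_choose_half_add_one_le (n : ℕ) (hn : 1 ≤ n) :
    (n : ℝ) * (n.choose (n / 2) : ℝ) + 1 ≤ 2 ^ n * √n := by
  rcases Nat.lt_or_ge n 2 with h2 | h2
  · obtain rfl : n = 1 := by omega
    norm_num
  have hc : ((n.choose (n / 2) : ℝ)) ^ 2 * (3 * n + 2) ≤ 2 * 4 ^ n := by
    exact_mod_cast choose_half_sq_mul_le n
  -- After squaring, `hc` leaves `n²c²/2 + nc²` to absorb `2nc + 1`; this uses `c ≥ 2`, hence the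
  -- separate case `n = 1`, where equality holds.
  have hc2 : (2 : ℝ) ≤ (n.choose (n / 2) : ℝ) := by
    have h1 : n.choose 1 ≤ n.choose (n / 2) := Nat.choose_le_middle 1 n
    rw [Nat.choose_one_right] at h1
    exact_mod_cast h2.trans h1
  have hn' : (2 : ℝ) ≤ n := by exact_mod_cast h2
  generalize ((n.choose (n / 2) : ℝ)) = c at hc hc2 ⊢
  refine le_of_sq_le_sq ?_ (by positivity)
  have h4 : ((2 : ℝ) ^ n * √n) ^ 2 = 4 ^ n * n := by
    rw [mul_pow, Real.sq_sqrt (by positivity), ← pow_mul, mul_comm n 2, pow_mul]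
    norm_num
  rw [h4]
  have h5 : (n * c ^ 2) * 2 ≤ (n * c ^ 2) * n := by gcongr
  have h6 : (n : ℝ) * c * 2 ≤ n * c * c := by gcongr
  have h7 : c ^ 2 * (3 * n + 2) * n ≤ 2 * 4 ^ n * n := by gcongr
  have h8 : (2 : ℝ) * 2 ^ 2 ≤ n * c ^ 2 := by gcongr
  nlinarith

/-! ### Stirling bounds for `log P(n)` -/

theorem log_binomProd_succ (n : ℕ) :
    Real.log (binomProd (n + 1)) =
      n * Real.log (n + 1) + Real.log (binomProd n) - Real.log n.factorial := by
  have h : (binomProd (n + 1) : ℝ) * n.factorial = (n + 1) ^ n * binomProd n := by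
    exact_mod_cast binomProd_succ_mul_factorial n
  have hp : ∀ k, (binomProd k : ℝ) ≠ 0 := fun k => by exact_mod_cast (binomProd_pos k).ne'
  have hl := congrArg Real.log h
  rw [Real.log_mul (hp _) (by positivity), Real.log_mul (by positivity) (hp _),
    Real.log_pow] at hl
  linarith

theorem log_pi_bound : 3 * Real.log Real.pi ≤ 5 * Real.log 2 := by
  have h : Real.pi ^ 3 ≤ 2 ^ 5 := by
    calc Real.pi ^ 3 ≤ 3.15 ^ 3 := by gcongr; exact Real.pi_lt_d2.le
      _ ≤ 2 ^ 5 := by norm_num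
  have h' := Real.log_le_log (by positivity) h
  rwa [Real.log_pow, Real.log_pow] at h'

theorem log_pi_bound_base : 3 * Real.log Real.pi + 4 ≤ 11 * Real.log 2 := by
  have h : Real.pi ^ 3 * (Real.exp 1) ^ 4 ≤ 2 ^ 11 := by
    calc Real.pi ^ 3 * (Real.exp 1) ^ 4 ≤ 3.15 ^ 3 * 2.72 ^ 4 := by
          gcongr
          · exact Real.pi_lt_d2.le
          · linarith [Real.exp_one_lt_d9]
      _ ≤ 2 ^ 11 := by norm_num
  have h' := Real.log_le_log (by positivity) h
  rw [Real.log_mul (by positivity) (by positivity), Real.log_pow, Real.log_pow, Real.log_pow,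
    Real.log_exp] at h'
  push_cast at h'
  linarith

theorem log_stirlingSeq_eq (n : ℕ) (hn : 1 ≤ n) :
    Real.log (Stirling.stirlingSeq n) =
      Real.log n.factorial - 1 / 2 * (Real.log 2 + Real.log n) - n * (Real.log n - 1) := by
  have hn' : (n : ℝ) ≠ 0 := by positivity
  rw [Stirling.log_stirlingSeq_formula, Real.log_mul two_ne_zero hn',
    Real.log_div hn' (Real.exp_ne_zero 1), Real.log_exp]

theorem half_log_pi_le_log_stirlingSeq (n : ℕ) (hn : 1 ≤ n) :
    1 / 2 * Real.log Real.pi ≤ Real.log (Stirling.stirlingSeq n) := by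
  have h := Real.log_le_log (by positivity)
    (Stirling.sqrt_pi_le_stirlingSeq (Nat.one_le_iff_ne_zero.mp hn))
  rw [Real.log_sqrt Real.pi_pos.le] at h
  linarith

theorem log_stirlingSeq_le (n : ℕ) (hn : 1 ≤ n) :
    Real.log (Stirling.stirlingSeq n) ≤ 1 - 1 / 2 * Real.log 2 := by
  obtain ⟨m, rfl⟩ : ∃ m, n = m + 1 := ⟨n - 1, by omega⟩
  have h := Stirling.log_stirlingSeq'_antitone (Nat.zero_le m)
  simp only [Function.comp, Nat.succ_eq_add_one, zero_add, Stirling.stirlingSeq_one] at h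
  rw [Real.log_div (Real.exp_ne_zero 1) (by positivity), Real.log_exp,
    Real.log_sqrt zero_le_two] at h
  linarith

/-- In the induction step write `-log n! = (1/2) log n! - (3/2) log n!` and apply Stirling at `n` to
the first part and at `n + 1` to the second. All terms in `log n` and `log (n+1)` cancel, and what
remains is `π³ ≤ 2⁵`. The base case is `π³ e⁴ ≤ 2¹¹`. -/
theorem log_binomProd_le (n : ℕ) (hn : 1 ≤ n) :
    Real.log (binomProd n) + (n / 2 + 1 / 4) * Real.log n ≤
      9 / 4 * Real.log 2 + 3 / 4 * Real.log Real.pi - 3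
        + n * (1 / 2 * Real.log 2 + 3 / 2 - 3 / 2 * Real.log Real.pi) + n ^ 2 / 2 := by
  induction n, hn using Nat.le_induction with
  | base =>
    have := log_pi_bound_base
    simp only [binomProd_one, Nat.cast_one, Real.log_one]
    linarith
  | succ n hn ih =>
    have h1 := log_stirlingSeq_eq n hn
    have h2 := log_stirlingSeq_eq (n + 1) (by omega)
    have h3 := log_stirlingSeq_le n hn
    have h4 := half_log_pi_le_log_stirlingSeq (n + 1) (by omega)
    have h5 := log_pi_bound
    rw [log_binomProd_succ]
    rw [Nat.factorial_succ, Nat.cast_mul, Real.log_mul (by positivity) (by positivity)] at h2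
    push_cast at h2 ⊢
    nlinarith

/-! ### Explicit bounds for `κ₀` -/

theorem kappaZero_le (d : ℕ) (hd : 1 ≤ d) :
    kappaZero d ≤ 40 * (2 : ℝ) ^ (1 / 4 : ℝ) * Real.pi ^ (3 / 4 : ℝ) * Real.exp (-3)
          * (d : ℝ) ^ (-(1 / 4) : ℝ)
          * (4 * Real.sqrt 2 * Real.exp (3 / 2) * Real.pi ^ (-(3 / 2) : ℝ)) ^ d
          * (2 * Real.sqrt (Real.exp 1)) ^ (d ^ 2) := by
  have hd' : (0 : ℝ) < d := by positivity
  have hP : (0 : ℝ) < binomProd d := by exact_mod_cast binomProd_pos d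
  have hA : (binomConv d : ℝ) ≤ 5 / 2 * binomProd d := by
    have h : (2 : ℝ) * binomConv d ≤ 5 * binomProd d := by
      exact_mod_cast two_mul_binomConv_le d hd
    linarith
  -- The factor `d^(d/2)` arising here is cancelled by the bound on `log P(d)`, which leaves
  -- `d^(-1/4)`.
  have h1 : kappaZero d ≤ 4 ^ (d + 1) * (5 / 2 * binomProd d) * (2 ^ d * √d) ^ d := by
    rw [kappaZero]
    gcongr
    exact mul_choose_half_add_one_le d hd
  refine h1.trans ?_
  have hpi := Real.pi_pos
  rw [← Real.log_le_log_iff (by positivity) (by positivity)]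
  have hsq : √(d : ℝ) ≠ 0 := by positivity
  have hl4 : Real.log 4 = 2 * Real.log 2 := by
    rw [show (4 : ℝ) = 2 ^ 2 by norm_num, Real.log_pow]; norm_num
  have hl40 : Real.log 40 = 4 * Real.log 2 + Real.log (5 / 2) := by
    rw [show (40 : ℝ) = 2 ^ 4 * (5 / 2) by norm_num, Real.log_mul (by norm_num) (by norm_num),
      Real.log_pow]
    norm_num
  have hL : Real.log (4 ^ (d + 1) * (5 / 2 * binomProd d) * (2 ^ d * √d) ^ d) =
      (d + 1) * (2 * Real.log 2) + (Real.log (5 / 2) + Real.log (binomProd d))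
        + d * (d * Real.log 2 + Real.log d / 2) := by
    rw [Real.log_mul (by positivity) (by positivity), Real.log_mul (by positivity) (by positivity),
      Real.log_mul (by positivity) hP.ne', Real.log_pow, Real.log_pow,
      Real.log_mul (by positivity) hsq, Real.log_pow, Real.log_sqrt hd'.le, hl4]
    push_cast
    ring
  rw [hL]
  have hR := log_binomProd_le d hd
  simp (disch := positivity) only [Real.log_mul, Real.log_pow, Real.log_rpow, Real.log_exp,
    Real.log_sqrt (Real.exp_pos 1).le, Real.log_sqrt (zero_le_two (α := ℝ)), hl40, hl4]
  push_cast
  linarith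

theorem explicit_constant_le (d : ℕ) (hd : 1 ≤ d) :
    40 * (2 : ℝ) ^ (1 / 4 : ℝ) * Real.pi ^ (3 / 4 : ℝ) * Real.exp (-3)
          * (d : ℝ) ^ (-(1 / 4) : ℝ)
          * (4 * Real.sqrt 2 * Real.exp (3 / 2) * Real.pi ^ (-(3 / 2) : ℝ)) ^ d
          * (2 * Real.sqrt (Real.exp 1)) ^ (d ^ 2)
      ≤ 5.59 * (15.01 : ℝ) ^ (d ^ 2) := by
  have hpi := Real.pi_pos
  have he := Real.exp_one_gt_d9
  have he' := Real.exp_one_lt_d9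
  have hp := Real.pi_gt_d6
  have hp' := Real.pi_lt_d6
  have rpow4 : ∀ (x y : ℝ), 0 ≤ x → (x ^ y) ^ 4 = x ^ (y * 4) := fun x y hx => by
    rw [Real.rpow_mul hx]; norm_num
  have exp4 : ∀ x : ℝ, (Real.exp x) ^ 4 = Real.exp (4 * x) := fun x => by
    rw [← Real.exp_nat_mul]; norm_num
  have exp2 : ∀ x : ℝ, (Real.exp x) ^ 2 = Real.exp (2 * x) := fun x => by
    rw [← Real.exp_nat_mul]; norm_num
  have hc : (2 * √(Real.exp 1)) ^ 2 = 4 * Real.exp 1 := by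
    rw [mul_pow, Real.sq_sqrt (Real.exp_pos 1).le]; norm_num
  have hC0 : 40 * (2 : ℝ) ^ (1 / 4 : ℝ) * Real.pi ^ (3 / 4 : ℝ) * Real.exp (-3) ≤ 5.59 := by
    refine le_of_pow_le_pow_left₀ (n := 4) (by norm_num) (by norm_num) ?_
    have h : (40 * (2 : ℝ) ^ (1 / 4 : ℝ) * Real.pi ^ (3 / 4 : ℝ) * Real.exp (-3)) ^ 4
        = 40 ^ 4 * 2 * Real.pi ^ 3 / (Real.exp 1) ^ 12 := by
      rw [mul_pow, mul_pow, mul_pow, rpow4 _ _ zero_le_two, rpow4 _ _ hpi.le, exp4,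
        ← Real.exp_nat_mul, div_eq_mul_inv _ (Real.exp _), ← Real.exp_neg]
      norm_num
    rw [h, div_le_iff₀ (by positivity)]
    calc 40 ^ 4 * 2 * Real.pi ^ 3 ≤ 40 ^ 4 * 2 * 3.141593 ^ 3 := by gcongr
      _ ≤ 5.59 ^ 4 * 2.7182818283 ^ 12 := by norm_num
      _ ≤ 5.59 ^ 4 * (Real.exp 1) ^ 12 := by gcongr
  -- For `d = 1` the product of the two bases slightly exceeds 15.01, so it must be estimated
  -- together with the leading constant. For `d ≥ 2` there is ample room.
  rcases Nat.lt_or_ge d 2 with h2 | h2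
  · obtain rfl : d = 1 := by omega
    simp only [Nat.cast_one, Real.one_rpow, mul_one, pow_one, one_pow]
    refine le_of_pow_le_pow_left₀ (n := 4) (by norm_num) (by norm_num) ?_
    have h : (40 * (2 : ℝ) ^ (1 / 4 : ℝ) * Real.pi ^ (3 / 4 : ℝ) * Real.exp (-3)
        * (4 * Real.sqrt 2 * Real.exp (3 / 2) * Real.pi ^ (-(3 / 2) : ℝ))
        * (2 * Real.sqrt (Real.exp 1))) ^ 4
        = 320 ^ 4 * 8 / (Real.pi ^ 3 * (Real.exp 1) ^ 4) := by
      have hs2 : (√2 : ℝ) ^ 4 = 4 := by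
        rw [show 4 = 2 * 2 by norm_num, pow_mul, Real.sq_sqrt zero_le_two]; norm_num
      have hse : (√(Real.exp 1) : ℝ) ^ 4 = Real.exp 2 := by
        rw [show 4 = 2 * 2 by norm_num, pow_mul, Real.sq_sqrt (Real.exp_pos 1).le, exp2]
        norm_num
      have hpi1 : (Real.pi ^ (3 / 4 : ℝ)) ^ 4 = Real.pi ^ 3 := by
        rw [rpow4 _ _ hpi.le]; norm_num
      have hpi2 : (Real.pi ^ (-(3 / 2) : ℝ)) ^ 4 = (Real.pi ^ 6)⁻¹ := by
        rw [rpow4 _ _ hpi.le, show (-(3 / 2) * 4 : ℝ) = -((6 : ℕ) : ℝ) by norm_num,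
          Real.rpow_neg hpi.le, Real.rpow_natCast]
      have h21 : ((2 : ℝ) ^ (1 / 4 : ℝ)) ^ 4 = 2 := by
        rw [rpow4 _ _ zero_le_two]; norm_num
      simp only [mul_pow, hs2, hse, hpi1, hpi2, h21]
      rw [exp4, exp4, exp4]
      have hexp : Real.exp (4 * -3) * Real.exp (4 * (3 / 2)) * Real.exp 2
          = (Real.exp (4 * 1))⁻¹ := by
        rw [← Real.exp_neg, ← Real.exp_add, ← Real.exp_add]; norm_num
      rw [div_eq_mul_inv _ (_ * Real.exp (4 * 1)), mul_inv, ← hexp]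
      field_simp
      norm_num
    rw [h, div_le_iff₀ (by positivity)]
    calc (320 : ℝ) ^ 4 * 8 ≤ (5.59 * 15.01) ^ 4 * (3.141592 ^ 3 * 2.7182818283 ^ 4) := by norm_num
      _ ≤ _ := by gcongr
  · have hb : 4 * √2 * Real.exp (3 / 2) * Real.pi ^ (-(3 / 2) : ℝ) ≤ 6 := by
      refine le_of_sq_le_sq ?_ (by norm_num)
      have h : (4 * √2 * Real.exp (3 / 2) * Real.pi ^ (-(3 / 2) : ℝ)) ^ 2
          = 32 * (Real.exp 1) ^ 3 / Real.pi ^ 3 := by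
        rw [mul_pow, mul_pow, mul_pow, Real.sq_sqrt zero_le_two, exp2,
          ← Real.rpow_mul_natCast hpi.le, show (-(3 / 2) * (2 : ℕ) : ℝ) = -((3 : ℕ) : ℝ) by norm_num,
          Real.rpow_neg hpi.le, Real.rpow_natCast, ← Real.exp_nat_mul]
        norm_num
        rw [div_eq_mul_inv]
      rw [h, div_le_iff₀ (by positivity)]
      have : Real.exp 1 ^ 3 ≤ Real.pi ^ 3 := by gcongr; linarith
      nlinarith [pow_pos hpi 3]
    have hc' : 2 * √(Real.exp 1) ≤ 15.01 := by
      refine le_of_sq_le_sq ?_ (by norm_num)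
      rw [hc]; linarith
    have hbc : (4 * √2 * Real.exp (3 / 2) * Real.pi ^ (-(3 / 2) : ℝ)) * (2 * √(Real.exp 1)) ^ d
        ≤ 15.01 ^ d := by
      obtain ⟨m, rfl⟩ : ∃ m, d = 2 + m := ⟨d - 2, by omega⟩
      rw [pow_add, hc, pow_add]
      calc (4 * √2 * Real.exp (3 / 2) * Real.pi ^ (-(3 / 2) : ℝ))
            * (4 * Real.exp 1 * (2 * √(Real.exp 1)) ^ m)
          ≤ 6 * (4 * 2.7182818286 * 15.01 ^ m) := by gcongr
        _ = (6 * (4 * 2.7182818286)) * 15.01 ^ m := by ring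
        _ ≤ 15.01 ^ 2 * 15.01 ^ m := by gcongr; norm_num
    have hd1 : (d : ℝ) ^ (-(1 / 4) : ℝ) ≤ 1 :=
      Real.rpow_le_one_of_one_le_of_nonpos (by exact_mod_cast hd) (by norm_num)
    rw [mul_assoc _ (_ ^ d), sq d, pow_mul, ← mul_pow, pow_mul]
    calc _ ≤ 5.59 * 1 * ((15.01 : ℝ) ^ d) ^ d := by gcongr
      _ = _ := by ring

/-! ### Coefficient vectors -/

theorem coeff_sum_C_mul_X_pow_sub {R : Type*} [Semiring R] (d : ℕ) (w : Fin (d + 1) → R)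
    (i : Fin (d + 1)) :
    (∑ j : Fin (d + 1), C (w j) * X ^ (d - (j : ℕ))).coeff (d - (i : ℕ)) = w i := by
  simp only [finsetSum_coeff, coeff_C_mul, coeff_X_pow]
  rw [Finset.sum_eq_single i]
  · simp
  · intro j _ hji
    rw [if_neg, mul_zero]
    intro h
    apply hji
    ext
    omega
  · simp

theorem natDegree_sum_C_mul_X_pow_sub_le {R : Type*} [Semiring R] (d : ℕ) (w : Fin (d + 1) → R) :
    (∑ j : Fin (d + 1), C (w j) * X ^ (d - (j : ℕ))).natDegree ≤ d :=
  natDegree_sum_le_of_forall_le _ _ fun _ _ =>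
    (natDegree_C_mul_X_pow_le _ _).trans (Nat.sub_le _ _)

theorem coeff_polyOfVec (d : ℕ) (w : Fin (d + 1) → ℝ) (i : Fin (d + 1)) :
    (polyOfVec d w).coeff (d - (i : ℕ)) = w i :=
  coeff_sum_C_mul_X_pow_sub d w i

theorem natDegree_polyOfVec_le (d : ℕ) (w : Fin (d + 1) → ℝ) : (polyOfVec d w).natDegree ≤ d :=
  natDegree_sum_C_mul_X_pow_sub_le d w

theorem eq_of_natDegree_le_of_coeff_sub {R : Type*} [Semiring R] {d : ℕ} {f g : R[X]}
    (hf : f.natDegree ≤ d) (hg : g.natDegree ≤ d)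
    (h : ∀ i : Fin (d + 1), f.coeff (d - (i : ℕ)) = g.coeff (d - (i : ℕ))) : f = g := by
  ext n
  rcases le_or_gt n d with hn | hn
  · have := h ⟨d - n, by omega⟩
    simpa [Nat.sub_sub_self hn] using this
  · rw [coeff_eq_zero_of_natDegree_lt (hf.trans_lt hn),
      coeff_eq_zero_of_natDegree_lt (hg.trans_lt hn)]

theorem polyOfVec_coeff_sub (d : ℕ) (f : ℝ[X]) (hf : f.natDegree ≤ d) :
    polyOfVec d (fun i => f.coeff (d - (i : ℕ))) = f :=
  eq_of_natDegree_le_of_coeff_sub (natDegree_polyOfVec_le _ _) hf fun i => coeff_polyOfVec _ _ i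

/-! ### Continuity of the Mahler measure -/

/-- A constant multiple of a product of `d` linear forms `u X - v`. -/
noncomputable def linProd {d : ℕ} (q : ℂ × (Fin d → ℂ × ℂ)) : ℂ[X] :=
  C q.1 * ∏ i, (C (q.2 i).1 * X - C (q.2 i).2)

theorem natDegree_linProd_le {d : ℕ} (q : ℂ × (Fin d → ℂ × ℂ)) : (linProd q).natDegree ≤ d := by
  refine (natDegree_C_mul_le _ _).trans ((natDegree_prod_le _ _).trans ?_)
  calc _ ≤ ∑ i : Fin d, 1 := by
        refine Finset.sum_le_sum fun i _ => ?_
        refine (natDegree_sub_C).le.trans ?_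
        exact (natDegree_C_mul_le _ _).trans natDegree_X_le
    _ = d := by simp

theorem continuous_coeff_prod {ι Y : Type*} [TopologicalSpace Y] (s : Finset ι) (f : ι → Y → ℂ[X])
    (hf : ∀ i n, Continuous fun y => (f i y).coeff n) (n : ℕ) :
    Continuous fun y => (∏ i ∈ s, f i y).coeff n := by
  classical
  induction s using Finset.induction_on generalizing n with
  | empty => simpa using continuous_const
  | insert a s ha ih =>
    simp only [Finset.prod_insert ha, coeff_mul]
    exact continuous_finsetSum _ fun p _ => (hf a p.1).mul (ih p.2)

theorem continuous_coeff_linProd (d n : ℕ) :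
    Continuous fun q : ℂ × (Fin d → ℂ × ℂ) => (linProd q).coeff n := by
  simp only [linProd, coeff_C_mul]
  refine continuous_fst.mul (continuous_coeff_prod _ _ (fun i m => ?_) n)
  simp only [coeff_sub, coeff_C_mul, coeff_C, coeff_X]
  split_ifs <;> fun_prop

theorem mahlerMeasure_C_mul_X_sub_C_of_norm_eq_one {p : ℂ × ℂ} (hp : ‖p‖ = 1) :
    (C p.1 * X - C p.2).mahlerMeasure = 1 := by
  rw [Prod.norm_def] at hp
  by_cases hu : p.1 = 0
  · have h2 : ‖p.2‖ = 1 := by simpa [hu] using hp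
    rw [hu, map_zero, zero_mul, zero_sub, ← C_neg, mahlerMeasure_const, norm_neg, h2]
  · rw [sub_eq_add_neg, ← C_neg, mahlerMeasure_C_mul_X_add_C hu, norm_neg, hp]

theorem mahlerMeasure_prod {ι : Type*} (s : Finset ι) (f : ι → ℂ[X]) :
    (∏ i ∈ s, f i).mahlerMeasure = ∏ i ∈ s, (f i).mahlerMeasure := by
  classical
  induction s using Finset.induction_on with
  | empty => simp
  | insert a s ha ih => rw [Finset.prod_insert ha, Finset.prod_insert ha, mahlerMeasure_mul, ih]

theorem mahlerMeasure_linProd {d : ℕ} (q : ℂ × (Fin d → ℂ × ℂ)) (hq : ∀ i, ‖q.2 i‖ = 1) :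
    (linProd q).mahlerMeasure = ‖q.1‖ := by
  rw [linProd, mahlerMeasure_mul, mahlerMeasure_const, mahlerMeasure_prod,
    Finset.prod_eq_one fun i _ => mahlerMeasure_C_mul_X_sub_C_of_norm_eq_one (hq i), mul_one]

theorem exists_eq_linProd (d : ℕ) (f : ℂ[X]) (hf : f.natDegree ≤ d) :
    ∃ q : ℂ × (Fin d → ℂ × ℂ), (∀ i, ‖q.2 i‖ = 1) ∧ f = linProd q := by
  induction d generalizing f with
  | zero =>
    obtain ⟨c, rfl⟩ := natDegree_eq_zero.mp (Nat.le_zero.mp hf)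
    exact ⟨(c, Fin.elim0), fun i => i.elim0, by simp [linProd]⟩
  | succ d ih =>
    by_cases h : f.natDegree ≤ d
    · obtain ⟨q, hq, rfl⟩ := ih f h
      -- Missing degree is padded with the constant form `0 X - (-1) = 1`, a root at infinity.
      refine ⟨(q.1, Fin.cons (0, -1) q.2), fun i => ?_, ?_⟩
      · refine Fin.cases ?_ (fun j => ?_) i
        · simp [Prod.norm_def]
        · simpa using hq j
      · simp [linProd, Fin.prod_univ_succ]
    · have hdeg : f.degree ≠ 0 := fun h0 => h (by
        rw [natDegree_eq_of_degree_eq_some h0]; exact Nat.zero_le d)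
      obtain ⟨z, hz⟩ := IsAlgClosed.exists_root f hdeg
      obtain ⟨g, rfl⟩ := dvd_iff_isRoot.mpr hz
      have hg0 : g ≠ 0 := by
        rintro rfl
        simp at h
      have hg : g.natDegree ≤ d := by
        rw [natDegree_mul (X_sub_C_ne_zero z) hg0, natDegree_X_sub_C] at hf
        omega
      obtain ⟨q, hq, rfl⟩ := ih g hg
      have hm : (0 : ℝ) < max 1 ‖z‖ := lt_max_of_lt_left one_pos
      have hm' : ((max 1 ‖z‖ : ℝ) : ℂ) ≠ 0 := by exact_mod_cast hm.ne'
      refine ⟨(q.1 * (max 1 ‖z‖ : ℝ),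
        Fin.cons (((max 1 ‖z‖ : ℝ) : ℂ)⁻¹, ((max 1 ‖z‖ : ℝ) : ℂ)⁻¹ * z) q.2), fun i => ?_, ?_⟩
      · refine Fin.cases ?_ (fun j => ?_) i
        · simp only [Fin.cons_zero, Prod.norm_def, norm_mul, norm_inv, Complex.norm_real,
            Real.norm_of_nonneg hm.le]
          rw [← mul_one (max 1 ‖z‖)⁻¹, mul_assoc, ← mul_max_of_nonneg _ _ (by positivity), one_mul,
            inv_mul_cancel₀ hm.ne']
        · simpa using hq j
      · simp only [linProd, Fin.prod_univ_succ, Fin.cons_zero, Fin.cons_succ]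
        have h1 : (X - C z : ℂ[X]) = C ((max 1 ‖z‖ : ℝ) : ℂ) *
            (C ((max 1 ‖z‖ : ℝ) : ℂ)⁻¹ * X - C (((max 1 ‖z‖ : ℝ) : ℂ)⁻¹ * z)) := by
          rw [mul_sub, ← mul_assoc, ← C_mul, ← C_mul, mul_inv_cancel_left₀ hm', mul_inv_cancel₀ hm',
            C_1, one_mul]
        have h2 : C (q.1 * ((max 1 ‖z‖ : ℝ) : ℂ)) = C q.1 * C ((max 1 ‖z‖ : ℝ) : ℂ) := C_mul
        rw [h1, h2]
        ring

/-- Forms `u X - v` with `max(|u|,|v|) = 1` have Mahler measure 1, so `μ` is the modulus of the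
leading constant in `linProd`. The normalised data form a compact set, even where the degree drops,
and its image under the continuous coefficient map is closed. -/
theorem isClosed_vecMahler_mem_Icc (d : ℕ) (a b : ℝ) :
    IsClosed {w : Fin (d + 1) → ℝ | vecMahler d w ∈ Set.Icc a b} := by
  let K : Set (ℂ × (Fin d → ℂ × ℂ)) :=
    (Metric.closedBall 0 b ∩ {c | a ≤ ‖c‖}) ×ˢ Set.pi Set.univ fun _ => Metric.sphere 0 1
  have hK : IsCompact K :=
    ((isCompact_closedBall _ _).inter_right (isClosed_le continuous_const continuous_norm)).prod
      (isCompact_univ_pi fun _ => isCompact_sphere _ _)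
  let Ψ : ℂ × (Fin d → ℂ × ℂ) → Fin (d + 1) → ℂ := fun q i => (linProd q).coeff (d - (i : ℕ))
  have hΨ : Continuous Ψ := continuous_pi fun i => continuous_coeff_linProd d _
  have hcl : IsClosed (Ψ '' K) := (hK.image hΨ).isClosed
  have hE : Continuous fun (w : Fin (d + 1) → ℝ) (i : Fin (d + 1)) => (w i : ℂ) := by fun_prop
  convert hcl.preimage hE using 1
  ext w
  have hdeg : ((polyOfVec d w).map Complex.ofRealHom).natDegree ≤ d :=
    natDegree_map_le.trans (natDegree_polyOfVec_le d w)
  simp only [Set.mem_ofPred_eq, Set.mem_preimage, Set.mem_image]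
  constructor
  · intro h
    obtain ⟨q, hq, hfq⟩ := exists_eq_linProd d _ hdeg
    rw [vecMahler, mapMahlerMeasure_eq, hfq, mahlerMeasure_linProd q hq] at h
    refine ⟨q, ⟨⟨by simpa using h.2, h.1⟩, fun i _ => by simpa using hq i⟩, ?_⟩
    funext i
    simp only [Ψ, ← hfq, coeff_map, coeff_polyOfVec, Complex.ofRealHom_eq_coe]
  · rintro ⟨q, ⟨⟨h1, h2⟩, h3⟩, h4⟩
    have hq : ∀ i, ‖q.2 i‖ = 1 := fun i => by simpa using h3 i trivial
    have hfq : (polyOfVec d w).map Complex.ofRealHom = linProd q := by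
      refine eq_of_natDegree_le_of_coeff_sub hdeg (natDegree_linProd_le q) fun i => ?_
      rw [coeff_map, coeff_polyOfVec]
      exact (congrFun h4 i).symm
    rw [vecMahler, mapMahlerMeasure_eq, hfq, mahlerMeasure_linProd q hq]
    exact ⟨h2, by simpa using h1⟩

theorem isometry_ofRealHom : Isometry Complex.ofRealHom := Complex.isometry_ofReal

theorem vecMahler_nonneg (d : ℕ) (w : Fin (d + 1) → ℝ) : 0 ≤ vecMahler d w :=
  mapMahlerMeasure_nonneg _ _

theorem vecMahler_le_sum (d : ℕ) (w : Fin (d + 1) → ℝ) : vecMahler d w ≤ ∑ i, ‖w i‖ := by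
  refine (mapMahlerMeasure_le_sum_norm_coeff _ _ isometry_ofRealHom).trans ?_
  rw [sum_over_range' _ (fun _ => norm_zero) (d + 1)
    (Nat.lt_succ_of_le (natDegree_polyOfVec_le d w)), Finset.sum_range,
    ← Equiv.sum_comp Fin.revPerm]
  refine (Finset.sum_congr rfl fun i _ => ?_).le
  rw [Fin.revPerm_apply, Fin.val_rev, show d + 1 - ((i : ℕ) + 1) = d - i by omega, coeff_polyOfVec]

theorem continuous_vecMahler (d : ℕ) : Continuous (vecMahler d) := by
  rw [continuous_iff_lower_upperSemicontinuous]
  constructor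
  · rw [lowerSemicontinuous_iff_isClosed_preimage]
    intro b
    convert isClosed_vecMahler_mem_Icc d 0 b using 1
    ext w
    simp [vecMahler_nonneg]
  · intro w a hw
    -- Near `w` the measure stays below `R`, so `μ ≥ a` there means `μ ∈ [a, R]`, a closed
    -- condition.
    obtain ⟨R, hR⟩ := exists_gt (∑ i, ‖w i‖)
    have hU : IsOpen {v : Fin (d + 1) → ℝ | ∑ i, ‖v i‖ < R} :=
      isOpen_lt (by fun_prop) continuous_const
    have hV := (isClosed_vecMahler_mem_Icc d a R).isOpen_compl
    filter_upwards [hU.mem_nhds hR, hV.mem_nhds (x := w) (fun h => (not_le.mpr hw) h.1)] with v h1 h2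
    by_contra h
    exact h2 ⟨not_lt.mp h, (vecMahler_le_sum d v).trans (le_of_lt h1)⟩

/-! ### Inner-outer factorization -/

/-- The monic real polynomials of degree `k` and Mahler measure `1`, i.e. those whose complex roots
lie in the closed unit disc. -/
structure IsInner (k : ℕ) (g : ℝ[X]) : Prop where
  monic : g.Monic
  natDegree_eq : g.natDegree = k
  mahler : g.mapMahlerMeasure Complex.ofRealHom = 1

/-- The real polynomials of degree at most `m`, constant coefficient `1` and Mahler measure `1`,
i.e. those without complex roots in the open unit disc. -/
structure IsOuter (m : ℕ) (h : ℝ[X]) : Prop where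
  natDegree_le : h.natDegree ≤ m
  coeff_zero : h.coeff 0 = 1
  mahler : h.mapMahlerMeasure Complex.ofRealHom = 1

theorem IsInner.one : IsInner 0 1 := ⟨monic_one, natDegree_one, mapMahlerMeasure_one _⟩

theorem IsOuter.one (m : ℕ) : IsOuter m 1 := ⟨by simp, by simp, mapMahlerMeasure_one _⟩

theorem IsInner.mul {k l : ℕ} {f g : ℝ[X]} (hf : IsInner k f) (hg : IsInner l g) :
    IsInner (k + l) (f * g) :=
  ⟨hf.monic.mul hg.monic, by rw [hf.monic.natDegree_mul hg.monic, hf.natDegree_eq, hg.natDegree_eq],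
    by rw [mapMahlerMeasure_mul, hf.mahler, hg.mahler, one_mul]⟩

theorem IsOuter.mul {k l : ℕ} {f g : ℝ[X]} (hf : IsOuter k f) (hg : IsOuter l g) :
    IsOuter (k + l) (f * g) :=
  ⟨natDegree_mul_le_of_le hf.natDegree_le hg.natDegree_le,
    by rw [mul_coeff_zero, hf.coeff_zero, hg.coeff_zero, one_mul],
    by rw [mapMahlerMeasure_mul, hf.mahler, hg.mahler, one_mul]⟩

theorem IsInner.coeff_self {k : ℕ} {g : ℝ[X]} (hg : IsInner k g) : g.coeff k = 1 := by
  rw [← hg.natDegree_eq]; exact hg.monic.coeff_natDegree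

theorem IsInner.abs_coeff_le {k : ℕ} {g : ℝ[X]} (hg : IsInner k g) (n : ℕ) :
    |g.coeff n| ≤ k.choose n := by
  have h := norm_coeff_le_choose_mul_mapMahlerMeasure _ isometry_ofRealHom n g
  rwa [hg.natDegree_eq, hg.mahler, mul_one] at h

theorem IsOuter.abs_coeff_le {m : ℕ} {h : ℝ[X]} (hh : IsOuter m h) (n : ℕ) :
    |h.coeff n| ≤ m.choose n := by
  have h' := norm_coeff_le_choose_mul_mapMahlerMeasure _ isometry_ofRealHom n h
  rw [hh.mahler, mul_one] at h'
  refine h'.trans ?_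
  exact_mod_cast Nat.choose_le_choose n hh.natDegree_le

/-- `f` is a constant times the product of an inner and an outer factor of complementary degrees. -/
def HasInnerOuter (d : ℕ) (f : ℝ[X]) : Prop :=
  ∃ (k m : ℕ) (c : ℝ) (g h : ℝ[X]), k + m = d ∧ f = C c * g * h ∧ IsInner k g ∧ IsOuter m h

theorem HasInnerOuter.mul {d e : ℕ} {p q : ℝ[X]} (hp : HasInnerOuter d p)
    (hq : HasInnerOuter e q) : HasInnerOuter (d + e) (p * q) := by
  obtain ⟨k, m, c, g, h, rfl, rfl, hg, hh⟩ := hp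
  obtain ⟨k', m', c', g', h', rfl, rfl, hg', hh'⟩ := hq
  exact ⟨k + k', m + m', c * c', g * g', h * h', by omega, by rw [C_mul]; ring, hg.mul hg',
    hh.mul hh'⟩

theorem hasInnerOuter_C (d : ℕ) (c : ℝ) : HasInnerOuter d (C c) :=
  ⟨0, d, c, 1, 1, by omega, by simp, IsInner.one, IsOuter.one d⟩

theorem IsInner.hasInnerOuter {k : ℕ} {g : ℝ[X]} (hg : IsInner k g) : HasInnerOuter k g :=
  ⟨k, 0, 1, g, 1, by omega, by simp, hg, IsOuter.one 0⟩

theorem hasInnerOuter_of_mahler_eq_coeff_zero {m : ℕ} {q : ℝ[X]} (hdeg : q.natDegree ≤ m)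
    (h0 : q.coeff 0 ≠ 0) (hq : q.mapMahlerMeasure Complex.ofRealHom = |q.coeff 0|) :
    HasInnerOuter m q := by
  refine ⟨0, m, q.coeff 0, 1, C (q.coeff 0)⁻¹ * q, by omega, ?_, IsInner.one, ?_, ?_, ?_⟩
  · rw [mul_one, ← mul_assoc, ← C_mul, mul_inv_cancel₀ h0, C_1, one_mul]
  · exact (natDegree_C_mul_le _ _).trans hdeg
  · rw [coeff_C_mul, inv_mul_cancel₀ h0]
  · rw [mapMahlerMeasure_mul, mapMahlerMeasure_const _ isometry_ofRealHom, hq, Real.norm_eq_abs,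
      abs_inv, inv_mul_cancel₀ (abs_ne_zero.mpr h0)]

theorem hasInnerOuter_X_sub_C (r : ℝ) : HasInnerOuter 1 (X - C r) := by
  have hm : (X - C r : ℝ[X]).mapMahlerMeasure Complex.ofRealHom = max 1 |r| := by
    rw [mapMahlerMeasure_eq]
    simp
  rcases le_or_gt |r| 1 with h | h
  · exact IsInner.hasInnerOuter ⟨monic_X_sub_C r, natDegree_X_sub_C r, by rw [hm, max_eq_left h]⟩
  · have hr : r ≠ 0 := by
      rintro rfl
      simp at h
      linarith
    refine hasInnerOuter_of_mahler_eq_coeff_zero (natDegree_X_sub_C r).le (by simpa using hr) ?_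
    rw [hm, max_eq_right h.le]
    simp

theorem hasInnerOuter_quadratic (z : ℂ) :
    HasInnerOuter 2 (X ^ 2 - C (2 * z.re) * X + C (‖z‖ ^ 2)) := by
  have hm : (X ^ 2 - C (2 * z.re) * X + C (‖z‖ ^ 2) : ℝ[X]).mapMahlerMeasure Complex.ofRealHom
      = (max 1 ‖z‖) ^ 2 := by
    have hfac : (X ^ 2 - C (2 * z.re) * X + C (‖z‖ ^ 2) : ℝ[X]).map Complex.ofRealHom
        = (X - C ((starRingEnd ℂ) z)) * (X - C z) := by
      have h1 : (z + (starRingEnd ℂ) z : ℂ) = ((2 * z.re : ℝ) : ℂ) := Complex.add_conj z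
      have h2 : ((starRingEnd ℂ) z * z : ℂ) = ((‖z‖ ^ 2 : ℝ) : ℂ) := by
        rw [Complex.conj_mul']; norm_cast
      simp only [Polynomial.map_add, Polynomial.map_sub, Polynomial.map_mul, Polynomial.map_pow,
        map_X, map_C, Complex.ofRealHom_eq_coe]
      rw [← h1, ← h2, C_add, C_mul]
      ring
    rw [mapMahlerMeasure_eq, hfac, mahlerMeasure_mul, mahlerMeasure_X_sub_C, mahlerMeasure_X_sub_C,
      RCLike.norm_conj, sq]
  have hform : (X ^ 2 - C (2 * z.re) * X + C (‖z‖ ^ 2) : ℝ[X])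
      = C 1 * X ^ 2 + C (-(2 * z.re)) * X + C (‖z‖ ^ 2) := by
    rw [C_neg, C_1]; ring
  have hdeg : (X ^ 2 - C (2 * z.re) * X + C (‖z‖ ^ 2) : ℝ[X]).natDegree = 2 := by
    rw [hform]; exact natDegree_quadratic one_ne_zero
  have hmon : (X ^ 2 - C (2 * z.re) * X + C (‖z‖ ^ 2) : ℝ[X]).Monic := by
    rw [Monic, hform]; exact leadingCoeff_quadratic one_ne_zero
  have h0 : (X ^ 2 - C (2 * z.re) * X + C (‖z‖ ^ 2) : ℝ[X]).coeff 0 = ‖z‖ ^ 2 := by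
    simp [coeff_zero_eq_eval_zero]
  rcases le_or_gt ‖z‖ 1 with h | h
  · exact IsInner.hasInnerOuter ⟨hmon, hdeg, by rw [hm, max_eq_left h, one_pow]⟩
  · refine hasInnerOuter_of_mahler_eq_coeff_zero hdeg.le ?_ ?_
    · rw [h0]; positivity
    · rw [h0, hm, max_eq_right h.le, abs_of_nonneg (by positivity)]

/-- Split off a real linear factor, or the real quadratic of a conjugate pair; conjugate roots have
equal modulus, so the quadratic falls entirely on one side. -/
theorem hasInnerOuter_of_natDegree_le (d : ℕ) (f : ℝ[X]) (hf : f.natDegree ≤ d) :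
    HasInnerOuter d f := by
  induction d using Nat.strong_induction_on generalizing f with
  | _ d ih =>
    by_cases h0 : f.natDegree = 0
    · obtain ⟨c, rfl⟩ := natDegree_eq_zero.mp h0
      exact hasInnerOuter_C d c
    have step : ∀ (e : ℕ) (q : ℝ[X]), 0 < e → q.natDegree = e → HasInnerOuter e q → q ∣ f →
        HasInnerOuter d f := by
      rintro e q he hq hqf ⟨p, rfl⟩
      have hp0 : p ≠ 0 := by
        rintro rfl
        simp at h0
      have hq0 : q ≠ 0 := by
        rintro rfl
        simp at h0
      rw [natDegree_mul hq0 hp0, hq] at hf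
      have := hqf.mul (ih (d - e) (by omega) p (by omega))
      rwa [Nat.add_sub_of_le (by omega)] at this
    have hdeg : f.degree ≠ 0 := fun h => h0 (natDegree_eq_of_degree_eq_some h)
    obtain ⟨z, hz⟩ := IsAlgClosed.exists_aeval_eq_zero ℂ f hdeg
    by_cases him : z.im = 0
    · have hzr : z = (z.re : ℂ) := Complex.ext rfl (by simpa using him)
      refine step 1 (X - C z.re) one_pos (natDegree_X_sub_C _) (hasInnerOuter_X_sub_C _) ?_
      rw [dvd_iff_isRoot, IsRoot.def]
      rw [hzr] at hz
      have h1 := aeval_algebraMap_apply ℂ z.re f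
      rw [Complex.coe_algebraMap, hz] at h1
      simpa using h1.symm
    · refine step 2 _ two_pos ?_ (hasInnerOuter_quadratic z)
        (quadratic_dvd_of_aeval_eq_zero_im_ne_zero f hz him)
      have hform : (X ^ 2 - C (2 * z.re) * X + C (‖z‖ ^ 2) : ℝ[X])
          = C 1 * X ^ 2 + C (-(2 * z.re)) * X + C (‖z‖ ^ 2) := by
        rw [C_neg, C_1]; ring
      rw [hform]; exact natDegree_quadratic one_ne_zero

/-! ### Stability of the product under perturbed factors -/

theorem abs_coeff_mul_le {f g : ℝ[X]} {K δ : ℝ} (s : Finset ℕ) (hf : ∀ n ∈ s, |f.coeff n| ≤ δ)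
    (hf0 : ∀ n ∉ s, f.coeff n = 0) (hg : ∀ n, |g.coeff n| ≤ K) (hδ : 0 ≤ δ) (n : ℕ) :
    |(f * g).coeff n| ≤ s.card * (K * δ) := by
  have hK : 0 ≤ K := (abs_nonneg _).trans (hg 0)
  rw [coeff_mul, Finset.Nat.sum_antidiagonal_eq_sum_range_succ (fun i j => f.coeff i * g.coeff j)]
  calc _ ≤ ∑ i ∈ Finset.range n.succ, |f.coeff i * g.coeff (n - i)| := Finset.abs_sum_le_sum_abs _ _
    _ ≤ ∑ i ∈ Finset.range n.succ, if i ∈ s then K * δ else 0 := by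
        refine Finset.sum_le_sum fun i _ => ?_
        rw [abs_mul]
        split_ifs with hi
        · rw [mul_comm K]
          exact mul_le_mul (hf i hi) (hg _) (abs_nonneg _) hδ
        · simp [hf0 i hi]
    _ = ((Finset.range n.succ).filter (· ∈ s)).card * (K * δ) := by
        rw [← Finset.sum_filter, Finset.sum_const, nsmul_eq_mul]
    _ ≤ s.card * (K * δ) := by
        gcongr
        intro i hi
        exact (Finset.mem_filter.mp hi).2

theorem choose_le_choose_half {k d : ℕ} (h : k ≤ d) (n : ℕ) : k.choose n ≤ d.choose (d / 2) :=
  (Nat.choose_le_choose n h).trans (Nat.choose_le_middle n d)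

theorem abs_coeff_inner_mul_outer_sub_le {d k m : ℕ} (hkm : k + m = d) {g g' h h' : ℝ[X]} {δ : ℝ}
    (hδ : 0 ≤ δ) (hg : IsInner k g) (hg' : IsInner k g') (hh : IsOuter m h) (hh' : IsOuter m h')
    (hgg : ∀ i < k, |g.coeff i - g'.coeff i| ≤ δ)
    (hhh : ∀ j < m, |h.coeff (j + 1) - h'.coeff (j + 1)| ≤ δ) (n : ℕ) :
    |(g * h - g' * h').coeff n| ≤ d * (d.choose (d / 2) * δ) := by
  -- The normalised coefficients cancel, so `g - g'` has at most `k` nonzero coefficients and `h -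
  -- h'` at most `m`; together this gives the factor `k + m = d`.
  have e : g * h - g' * h' = (g - g') * h + (h - h') * g' := by ring
  have h1 : |((g - g') * h).coeff n| ≤ (Finset.range k).card * (d.choose (d / 2) * δ) := by
    refine abs_coeff_mul_le _ (fun i hi => ?_) (fun i hi => ?_) (fun i => ?_) hδ n
    · rw [coeff_sub]
      exact hgg i (Finset.mem_range.mp hi)
    · rw [Finset.mem_range, not_lt] at hi
      rcases hi.eq_or_lt with rfl | hi
      · rw [coeff_sub, hg.coeff_self, hg'.coeff_self, sub_self]
      · rw [coeff_sub, coeff_eq_zero_of_natDegree_lt (by rwa [hg.natDegree_eq]),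
          coeff_eq_zero_of_natDegree_lt (by rwa [hg'.natDegree_eq]), sub_self]
    · exact (hh.abs_coeff_le i).trans (by exact_mod_cast choose_le_choose_half (by omega) i)
  have h2 : |((h - h') * g').coeff n| ≤ (Finset.Icc 1 m).card * (d.choose (d / 2) * δ) := by
    refine abs_coeff_mul_le _ (fun i hi => ?_) (fun i hi => ?_) (fun i => ?_) hδ n
    · obtain ⟨hi1, hi2⟩ := Finset.mem_Icc.mp hi
      have := hhh (i - 1) (by omega)
      rwa [Nat.sub_add_cancel hi1, ← coeff_sub] at this
    · rcases Nat.eq_zero_or_pos i with rfl | hi0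
      · rw [coeff_sub, hh.coeff_zero, hh'.coeff_zero, sub_self]
      · have him : m < i := by
          by_contra hc
          exact hi (Finset.mem_Icc.mpr ⟨hi0, not_lt.mp hc⟩)
        rw [coeff_sub, coeff_eq_zero_of_natDegree_lt (hh.natDegree_le.trans_lt him),
          coeff_eq_zero_of_natDegree_lt (hh'.natDegree_le.trans_lt him), sub_self]
    · exact (hg'.abs_coeff_le i).trans (by exact_mod_cast choose_le_choose_half (by omega) i)
  rw [e, coeff_add]
  refine (abs_add_le _ _).trans ((add_le_add h1 h2).trans_eq ?_)
  rw [Finset.card_range, Nat.card_Icc, ← add_mul, Nat.add_sub_cancel, ← hkm]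
  push_cast
  rfl

/-! ### Covering the level surface by labelled pieces -/

/-- The index set of a subdivision of the coefficient boxes of inner and outer factors into cubes of
side `1 / M`. -/
abbrev BoxLabel (d M : ℕ) : Type :=
  Σ k : Fin (d + 1), Bool × ((i : Fin k) → Fin (2 * (k : ℕ).choose i * M)) ×
    ((j : Fin (d - k)) → Fin (2 * (d - (k : ℕ)).choose (j + 1) * M))

/-- The normalised coefficient has no box, but its binomial coefficient is 1, so the side lengths
still multiply to `P(k)` and `P(d-k)` up to powers of 2. -/
theorem card_boxLabel (d M : ℕ) :
    Fintype.card (BoxLabel d M) = 2 ^ (d + 1) * binomConv d * M ^ d := by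
  have hin : ∀ k : ℕ, ∏ i : Fin k, 2 * k.choose i * M = (2 * M) ^ k * binomProd k := by
    intro k
    rw [binomProd, Finset.prod_range_succ, Nat.choose_self, mul_one,
      Finset.prod_congr rfl
        (fun (i : Fin k) _ => show 2 * k.choose i * M = (2 * M) * k.choose i by ring),
      Finset.prod_mul_distrib, Finset.prod_const, Finset.card_fin, Finset.prod_range]
  have hout : ∀ k : ℕ, ∏ i : Fin k, 2 * k.choose (i + 1) * M = (2 * M) ^ k * binomProd k := by
    intro k
    rw [binomProd, Finset.prod_range_succ', Nat.choose_zero_right, mul_one,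
      Finset.prod_congr rfl
        (fun (i : Fin k) _ => show 2 * k.choose (i + 1) * M = (2 * M) * k.choose (i + 1) by ring),
      Finset.prod_mul_distrib, Finset.prod_const, Finset.card_fin, Finset.prod_range]
  simp only [Fintype.card_sigma, Fintype.card_prod, Fintype.card_pi, Fintype.card_fin,
    Fintype.card_bool, hin, hout]
  rw [binomConv, Finset.sum_range, Finset.mul_sum, Finset.sum_mul]
  refine Finset.sum_congr rfl fun k _ => ?_
  have hk : (k : ℕ) + (d - k) = d := by omega
  calc 2 * ((2 * M) ^ (k : ℕ) * binomProd k * ((2 * M) ^ (d - (k : ℕ)) * binomProd (d - k)))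
      = 2 * (2 * M) ^ ((k : ℕ) + (d - k)) * (binomProd k * binomProd (d - k)) := by
        rw [pow_add]; ring
    _ = _ := by rw [hk, mul_pow]; ring

theorem exists_subdivision_index {c M : ℕ} (hc : 0 < c) (hM : 0 < M) {x : ℝ} (hx : |x| ≤ c) :
    ∃ a : Fin (2 * c * M), (a : ℝ) ≤ (x + c) * M ∧ (x + c) * M ≤ a + 1 := by
  obtain ⟨h1, h2⟩ := abs_le.mp hx
  have hN : 0 < 2 * c * M := by positivity
  have h0 : 0 ≤ (x + c) * M := mul_nonneg (by linarith) (Nat.cast_nonneg M)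
  have hle : (x + c) * M ≤ ((2 * c * M : ℕ) : ℝ) := by
    push_cast
    gcongr
    linarith
  by_cases h : ⌊(x + c) * M⌋₊ < 2 * c * M
  · exact ⟨⟨_, h⟩, Nat.floor_le h0, (Nat.lt_floor_add_one _).le⟩
  -- The right endpoint `x = c` goes into the last closed interval.
  · refine ⟨⟨2 * c * M - 1, by omega⟩, ?_, ?_⟩
    · exact (Nat.cast_le.mpr (by omega)).trans (Nat.floor_le h0)
    · refine hle.trans_eq ?_
      exact_mod_cast (Nat.sub_add_cancel hN).symm

theorem abs_sub_le_of_subdivision_index {a : ℕ} {c x y : ℝ} {M : ℕ} (hM : 0 < M)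
    (hx : (a : ℝ) ≤ (x + c) * M ∧ (x + c) * M ≤ a + 1)
    (hy : (a : ℝ) ≤ (y + c) * M ∧ (y + c) * M ≤ a + 1) : |x - y| ≤ 1 / M := by
  have hM' : (0 : ℝ) < M := by exact_mod_cast hM
  have h : |x - y| * M = |(x - y) * M| := by rw [abs_mul, abs_of_pos hM']
  rw [le_div_iff₀ hM', h, abs_le]
  constructor <;> linarith [hx.1, hx.2, hy.1, hy.2]

/-- `HasLabel T l w` means that `w` is the coefficient vector of `± T` times a product of an inner
and an outer factor whose coefficients lie in the cubes with label `l`. -/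
def HasLabel {d M : ℕ} (T : ℝ) (l : BoxLabel d M) (w : Fin (d + 1) → ℝ) : Prop :=
  ∃ g h : ℝ[X], IsInner l.1 g ∧ IsOuter (d - l.1) h ∧
    polyOfVec d w = C ((if l.2.1 then 1 else -1) * T) * (g * h) ∧
    (∀ i, (l.2.2.1 i : ℝ) ≤ (g.coeff i + (l.1 : ℕ).choose i) * M ∧
      (g.coeff i + (l.1 : ℕ).choose i) * M ≤ l.2.2.1 i + 1) ∧
    (∀ j, (l.2.2.2 j : ℝ) ≤ (h.coeff (j + 1) + (d - (l.1 : ℕ)).choose (j + 1)) * M ∧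
      (h.coeff (j + 1) + (d - (l.1 : ℕ)).choose (j + 1)) * M ≤ l.2.2.2 j + 1)

theorem exists_hasLabel {d M : ℕ} (hM : 0 < M) {w : Fin (d + 1) → ℝ} :
    ∃ l : BoxLabel d M, HasLabel (vecMahler d w) l w := by
  obtain ⟨k, m, c, g, h, hkm, hf, hg, hh⟩ :=
    hasInnerOuter_of_natDegree_le d _ (natDegree_polyOfVec_le d w)
  obtain rfl : m = d - k := by omega
  have hT : vecMahler d w = |c| := by
    rw [vecMahler, hf, mapMahlerMeasure_mul, mapMahlerMeasure_mul, hg.mahler, hh.mahler,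
      mapMahlerMeasure_const _ isometry_ofRealHom, Real.norm_eq_abs, mul_one, mul_one]
  choose a ha using fun i : Fin k => exists_subdivision_index (Nat.choose_pos i.2.le) hM
    (hg.abs_coeff_le i)
  choose b hb using fun j : Fin (d - k) => exists_subdivision_index
    (Nat.choose_pos (show (j : ℕ) + 1 ≤ d - k from j.2)) hM (hh.abs_coeff_le (j + 1))
  refine ⟨⟨⟨k, by omega⟩, decide (0 ≤ c), a, b⟩, g, h, hg, hh, ?_, ha, hb⟩
  rw [hf, hT, mul_assoc]
  congr 2
  by_cases hc : 0 ≤ c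
  · simp [hc, abs_of_nonneg hc]
  · simp [hc, abs_of_neg (not_le.mp hc)]

theorem HasLabel.abs_sub_le_one {d M : ℕ} {T : ℝ} (hT : 0 ≤ T) (hM : 0 < M)
    (hTM : d * d.choose (d / 2) * T ≤ M) {l : BoxLabel d M} {w w' : Fin (d + 1) → ℝ}
    (hw : HasLabel T l w) (hw' : HasLabel T l w') (i : Fin (d + 1)) : |w i - w' i| ≤ 1 := by
  obtain ⟨g, h, hg, hh, hf, ha, hb⟩ := hw
  obtain ⟨g', h', hg', hh', hf', ha', hb'⟩ := hw'
  have hM' : (0 : ℝ) < M := by exact_mod_cast hM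
  have hkm : (l.1 : ℕ) + (d - l.1) = d := by omega
  have key := abs_coeff_inner_mul_outer_sub_le hkm (by positivity : (0 : ℝ) ≤ 1 / M) hg hg' hh hh'
    (fun i hi => abs_sub_le_of_subdivision_index hM (ha ⟨i, hi⟩) (ha' ⟨i, hi⟩))
    (fun j hj => abs_sub_le_of_subdivision_index hM (hb ⟨j, hj⟩) (hb' ⟨j, hj⟩)) (d - i)
  rw [← coeff_polyOfVec d w i, ← coeff_polyOfVec d w' i, hf, hf', coeff_C_mul, coeff_C_mul,
    ← mul_sub, ← coeff_sub, abs_mul]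
  have hs : |(if l.2.1 then 1 else -1) * T| = T := by
    split_ifs <;> simp [abs_of_nonneg hT]
  rw [hs]
  calc _ ≤ T * (d * (d.choose (d / 2) * (1 / M))) := by gcongr
    _ = (d * d.choose (d / 2) * T) / M := by ring
    _ ≤ 1 := (div_le_one hM').mpr hTM

/-! ### Unit cubes, lattice points and volume -/

/-- The coordinatewise integer part. -/
noncomputable def floorVec {ι : Type*} (x : ι → ℝ) : ι → ℤ := fun i => ⌊x i⌋

theorem floorVec_preimage_singleton {ι : Type*} (z : ι → ℤ) :
    floorVec ⁻¹' {z} = Set.pi Set.univ fun i => Set.Ico (z i : ℝ) (z i + 1) := by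
  ext x
  simp [floorVec, funext_iff, Int.floor_eq_iff]

theorem floorVec_image_ncard_le {ι Λ : Type*} [Fintype ι] [Fintype Λ] (B : Set (ι → ℝ))
    (R : Λ → (ι → ℝ) → Prop) (hex : ∀ w ∈ B, ∃ l, R l w)
    (hR : ∀ l w w', R l w → R l w' → ∀ i, |w i - w' i| ≤ 1) :
    (floorVec '' B).Finite ∧ (floorVec '' B).ncard ≤ Fintype.card Λ * 2 ^ Fintype.card ι := by
  classical
  have h : ∀ z : floorVec '' B, ∃ l, ∃ w, R l w ∧ floorVec w = z := by
    rintro ⟨_, w, hw, rfl⟩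
    obtain ⟨l, hl⟩ := hex w hw
    exact ⟨l, w, hl, rfl⟩
  choose l w hl hw using h
  -- Cubes sharing a label have corners differing by at most 1 in each coordinate, so parities tell
  -- them apart; this is the factor `2^|ι|`.
  have hinj : Function.Injective
      fun z : floorVec '' B => (l z, fun i => ((z : ι → ℤ) i : ZMod 2)) := by
    intro z z' hz
    obtain ⟨h1, h2⟩ := Prod.mk.inj hz
    ext i
    have h3 := hR _ _ _ (hl z) (h1 ▸ hl z') i
    have h4 : (z : ι → ℤ) i = ⌊w z i⌋ := congrFun (hw z).symm i
    have h5 : (z' : ι → ℤ) i = ⌊w z' i⌋ := congrFun (hw z').symm i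
    have h6 := (ZMod.intCast_eq_intCast_iff_dvd_sub _ _ 2).mp (congrFun h2 i)
    obtain ⟨h7, h8⟩ := abs_le.mp h3
    have h9 : ⌊w z i⌋ ≤ ⌊w z' i⌋ + 1 := by
      rw [← Int.floor_add_one]; exact Int.floor_le_floor (by linarith)
    have h10 : ⌊w z' i⌋ ≤ ⌊w z i⌋ + 1 := by
      rw [← Int.floor_add_one]; exact Int.floor_le_floor (by linarith)
    push_cast at h6
    omega
  have hfin : Finite (floorVec '' B) := Finite.of_injective _ hinj
  refine ⟨hfin, ?_⟩
  have := Nat.card_le_card_of_injective _ hinj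
  rwa [Nat.card_coe_set_eq, Nat.card_eq_fintype_card, Fintype.card_prod, Fintype.card_fun,
    ZMod.card] at this

theorem volume_floorVec_preimage {ι : Type*} [Fintype ι] {A : Set (ι → ℤ)} (hA : A.Finite) :
    volume (floorVec ⁻¹' A : Set (ι → ℝ)) = A.ncard := by
  have hU : (floorVec ⁻¹' A : Set (ι → ℝ)) = ⋃ z ∈ hA.toFinset, floorVec ⁻¹' {z} := by
    ext x
    simp
  rw [hU, measure_biUnion_finset]
  · rw [Set.ncard_eq_toFinset_card A hA]
    simp [floorVec_preimage_singleton, Real.volume_pi_Ico]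
  · intro z _ z' _ hzz
    exact Disjoint.preimage _ (Set.disjoint_singleton.mpr hzz)
  · intro z _
    rw [floorVec_preimage_singleton]
    exact MeasurableSet.univ_pi fun _ => measurableSet_Ico

/-- The number of lattice points of a bounded set differs from its volume by at most the number of
half-open unit lattice cubes which meet both the set and its complement. -/
theorem abs_ncard_lattice_sub_volume_le {ι : Type*} [Fintype ι] {S : Set (ι → ℝ)}
    (hS : (floorVec '' S).Finite) {F : Set (ι → ℤ)} (hF : F.Finite)
    (hSF : ∀ x y, floorVec x = floorVec y → x ∈ S → y ∉ S → floorVec x ∈ F) :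
    {z : ι → ℤ | (fun i => (z i : ℝ)) ∈ S}.Finite ∧ volume S < ⊤ ∧
      |(({z : ι → ℤ | (fun i => (z i : ℝ)) ∈ S}.ncard : ℕ) : ℝ) - (volume S).toReal|
        ≤ F.ncard := by
  set Z := {z : ι → ℤ | (fun i => (z i : ℝ)) ∈ S}
  set J := floorVec '' S
  -- `I` indexes the cubes inside `S` and `J` those meeting `S`. Both the lattice count and the
  -- volume lie between `|I|` and `|J|`, and `J \ I ⊆ F`.
  let I : Set (ι → ℤ) := {z | ∀ x, floorVec x = z → x ∈ S}
  have hcast : ∀ z : ι → ℤ, floorVec (fun i => (z i : ℝ)) = z := fun z => by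
    funext i; simp [floorVec]
  have hIZ : I ⊆ Z := fun z hz => hz _ (hcast z)
  have hZJ : Z ⊆ J := fun z hz => ⟨_, hz, hcast z⟩
  have hJ : J ⊆ I ∪ F := by
    rintro _ ⟨x, hx, rfl⟩
    by_cases h : floorVec x ∈ I
    · exact Or.inl h
    · simp only [I, Set.mem_ofPred_eq, not_forall] at h
      obtain ⟨y, hy, hyS⟩ := h
      exact Or.inr (hSF x y hy.symm hx hyS)
  have hZfin := hS.subset hZJ
  have hIfin := hZfin.subset hIZ
  have h1 : (I.ncard : ENNReal) ≤ volume S := by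
    rw [← volume_floorVec_preimage hIfin]
    exact measure_mono fun x hx => hx x rfl
  have h2 : volume S ≤ (J.ncard : ENNReal) := by
    rw [← volume_floorVec_preimage hS]
    exact measure_mono (Set.subset_preimage_image _ _)
  have hlt : volume S < ⊤ := h2.trans_lt (ENNReal.natCast_lt_top _)
  refine ⟨hZfin, hlt, ?_⟩
  have h1' := ENNReal.toReal_mono hlt.ne h1
  have h2' := ENNReal.toReal_mono (ENNReal.natCast_ne_top _) h2
  rw [ENNReal.toReal_natCast] at h1' h2'
  have h3 : (I.ncard : ℝ) ≤ Z.ncard := by exact_mod_cast Set.ncard_le_ncard hIZ hZfin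
  have h4 : (Z.ncard : ℝ) ≤ J.ncard := by exact_mod_cast Set.ncard_le_ncard hZJ hS
  have h5 : (J.ncard : ℝ) ≤ I.ncard + F.ncard := by
    exact_mod_cast (Set.ncard_le_ncard hJ (hIfin.union hF)).trans (Set.ncard_union_le _ _)
  rw [abs_le]
  constructor <;> linarith

theorem exists_floorVec_eq_of_continuous {ι : Type*} {f : (ι → ℝ) → ℝ} (hf : Continuous f)
    {T : ℝ} {x y : ι → ℝ} (hxy : floorVec x = floorVec y) (hx : f x ≤ T) (hy : T ≤ f y) :
    ∃ w, f w = T ∧ floorVec w = floorVec x := by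
  have hc : IsPreconnected (floorVec ⁻¹' {floorVec x} : Set (ι → ℝ)) := by
    rw [floorVec_preimage_singleton]
    exact isPreconnected_univ_pi fun _ => isPreconnected_Ico
  obtain ⟨w, hw, rfl⟩ := hc.intermediate_value rfl hxy.symm hf.continuousOn ⟨hx, hy⟩
  exact ⟨w, rfl, hw⟩

/-! ### Scaling, integer polynomials and the final count -/

theorem abs_apply_le_mul_vecMahler (d : ℕ) (w : Fin (d + 1) → ℝ) (i : Fin (d + 1)) :
    |w i| ≤ d.choose (d / 2) * vecMahler d w := by
  rw [← coeff_polyOfVec d w i]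
  refine (norm_coeff_le_choose_mul_mapMahlerMeasure _ isometry_ofRealHom _ _).trans ?_
  gcongr
  · exact vecMahler_nonneg d w
  · exact choose_le_choose_half (natDegree_polyOfVec_le d w) _
  · exact le_rfl

theorem finite_floorVec_image_of_bounded {ι : Type*} [Finite ι] {S : Set (ι → ℝ)} {K : ℝ}
    (hS : ∀ x ∈ S, ∀ i, |x i| ≤ K) : (floorVec '' S).Finite := by
  refine (Set.Finite.pi' fun _ : ι => Set.finite_Icc ⌊-K⌋ ⌊K⌋).subset ?_
  rintro _ ⟨x, hx, rfl⟩ i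
  obtain ⟨h1, h2⟩ := abs_le.mp (hS x hx i)
  exact ⟨Int.floor_le_floor h1, Int.floor_le_floor h2⟩

theorem polyOfVec_smul (d : ℕ) (c : ℝ) (w : Fin (d + 1) → ℝ) :
    polyOfVec d (c • w) = C c * polyOfVec d w := by
  simp only [polyOfVec, Finset.mul_sum, Pi.smul_apply, smul_eq_mul, C_mul, mul_assoc]

theorem vecMahler_smul (d : ℕ) (c : ℝ) (w : Fin (d + 1) → ℝ) :
    vecMahler d (c • w) = |c| * vecMahler d w := by
  rw [vecMahler, polyOfVec_smul, mapMahlerMeasure_mul, mapMahlerMeasure_const _ isometry_ofRealHom,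
    Real.norm_eq_abs, vecMahler]

open scoped Pointwise in
theorem volume_vecMahler_le (d : ℕ) {T : ℝ} (hT : 0 < T) :
    (volume {w : Fin (d + 1) → ℝ | vecMahler d w ≤ T}).toReal
      = (volume (unitStarBody d)).toReal * T ^ (d + 1) := by
  have h : {w : Fin (d + 1) → ℝ | vecMahler d w ≤ T} = T • unitStarBody d := by
    ext w
    rw [Set.mem_smul_set_iff_inv_smul_mem₀ hT.ne', unitStarBody, Set.mem_ofPred_eq,
      Set.mem_ofPred_eq, vecMahler_smul, abs_of_pos (inv_pos.mpr hT), inv_mul_le_iff₀ hT, mul_one]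
  rw [h, Measure.addHaar_smul, ENNReal.toReal_mul, ENNReal.toReal_ofReal (abs_nonneg _),
    Module.finrank_fin_fun, abs_of_pos (by positivity), mul_comm]

theorem vecMahler_coeff_sub_intPoly (d : ℕ) (f : ℤ[X]) (hf : f.natDegree ≤ d) :
    vecMahler d (fun i => (f.coeff (d - (i : ℕ)) : ℝ))
      = f.mapMahlerMeasure (Int.castRingHom ℂ) := by
  have h := polyOfVec_coeff_sub d (f.map (Int.castRingHom ℝ)) (natDegree_map_le.trans hf)
  simp only [coeff_map, eq_intCast] at h
  rw [vecMahler, h, mapMahlerMeasure_eq, mapMahlerMeasure_eq, map_map]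
  congr 2

theorem image_coeff_sub_intPolys (d : ℕ) (T : ℝ) :
    (fun (f : ℤ[X]) (i : Fin (d + 1)) => f.coeff (d - (i : ℕ))) '' intPolys d T
      = {z : Fin (d + 1) → ℤ | (fun i => (z i : ℝ)) ∈ {w | vecMahler d w ≤ T}} := by
  ext z
  constructor
  · rintro ⟨f, ⟨hf, hfT⟩, rfl⟩
    simpa only [Set.mem_ofPred_eq,
      vecMahler_coeff_sub_intPoly d f (natDegree_le_of_degree_le hf)] using hfT
  · intro hz
    have hdeg := natDegree_sum_C_mul_X_pow_sub_le d z
    have hco := coeff_sum_C_mul_X_pow_sub d z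
    refine ⟨∑ j : Fin (d + 1), C (z j) * X ^ (d - (j : ℕ)), ⟨degree_le_of_natDegree_le hdeg, ?_⟩,
      funext hco⟩
    rw [← vecMahler_coeff_sub_intPoly d _ hdeg]
    simpa only [hco, Set.mem_ofPred_eq] using hz

theorem injOn_coeff_sub_intPolys (d : ℕ) (T : ℝ) :
    Set.InjOn (fun (f : ℤ[X]) (i : Fin (d + 1)) => f.coeff (d - (i : ℕ))) (intPolys d T) :=
  fun _ hf _ hg h => eq_of_natDegree_le_of_coeff_sub (natDegree_le_of_degree_le hf.1)
    (natDegree_le_of_degree_le hg.1) (congrFun h)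

theorem intPolys_count (d : ℕ) (hd : 1 ≤ d) {T : ℝ} (hT : 1 ≤ T) :
    (intPolys d T).Finite ∧ volume {w : Fin (d + 1) → ℝ | vecMahler d w ≤ T} < ⊤ ∧
      |((intPolys d T).ncard : ℝ) - (volume (unitStarBody d)).toReal * T ^ (d + 1)|
        ≤ kappaZero d * T ^ d := by
  have hT0 : 0 < T := one_pos.trans_le hT
  set L : ℝ := d * d.choose (d / 2) with hL
  have hLpos : 0 < L := by
    have : 0 < d.choose (d / 2) := Nat.choose_pos (Nat.div_le_self d 2)
    positivity
  set M : ℕ := ⌈L * T⌉₊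
  have hM : 0 < M := Nat.ceil_pos.mpr (by positivity)
  have hM1 : L * T ≤ M := Nat.le_ceil _
  -- `T ≥ 1` absorbs the rounding: `⌈L T⌉ ≤ L T + 1 ≤ (L + 1) T`.
  have hM2 : (M : ℝ) ≤ (L + 1) * T := by
    have := (Nat.ceil_lt_add_one (show 0 ≤ L * T by positivity)).le
    linarith
  obtain ⟨hBfin, hBcard⟩ := floorVec_image_ncard_le {w : Fin (d + 1) → ℝ | vecMahler d w = T}
    (HasLabel (M := M) T) (fun w hw => by
      obtain ⟨l, hl⟩ := exists_hasLabel (w := w) hM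
      exact ⟨l, by rwa [show vecMahler d w = T from hw] at hl⟩)
    (fun l w w' hw hw' => hw.abs_sub_le_one hT0.le hM hM1 hw')
  have hbdd : (floorVec '' {w : Fin (d + 1) → ℝ | vecMahler d w ≤ T}).Finite :=
    finite_floorVec_image_of_bounded (K := d.choose (d / 2) * T) fun w hw i =>
      (abs_apply_le_mul_vecMahler d w i).trans (by gcongr; exact hw)
  obtain ⟨h1, h2, h3⟩ := abs_ncard_lattice_sub_volume_le hbdd hBfin fun x y hxy hx hy => by
    obtain ⟨w, hw, hwx⟩ := exists_floorVec_eq_of_continuous (continuous_vecMahler d) hxy hx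
      (not_le.mp hy).le
    exact ⟨w, hw, hwx⟩
  rw [← image_coeff_sub_intPolys] at h1 h3
  rw [(injOn_coeff_sub_intPolys d T).ncard_image, volume_vecMahler_le d hT0] at h3
  refine ⟨h1.of_finite_image (injOn_coeff_sub_intPolys d T), h2, h3.trans ?_⟩
  rw [card_boxLabel, Fintype.card_fin] at hBcard
  calc ((floorVec '' {w : Fin (d + 1) → ℝ | vecMahler d w = T}).ncard : ℝ)
      ≤ 2 ^ (d + 1) * binomConv d * (M : ℝ) ^ d * 2 ^ (d + 1) := by exact_mod_cast hBcard
    _ = 4 ^ (d + 1) * binomConv d * (M : ℝ) ^ d := by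
        rw [show (4 : ℝ) = 2 * 2 by norm_num, mul_pow]; ring
    _ ≤ 4 ^ (d + 1) * binomConv d * ((L + 1) * T) ^ d := by gcongr
    _ = kappaZero d * T ^ d := by rw [kappaZero, mul_pow]; ring

end MahlerCount

theorem mainTheorem9 (d : ℕ) (hd : 1 ≤ d) :
    MeasureTheory.volume (MahlerCount.unitStarBody d) < ⊤ ∧
    (∀ T : ℝ, 1 ≤ T →
      (MahlerCount.intPolys d T).Finite ∧
      |((MahlerCount.intPolys d T).ncard : ℝ)
          - (MeasureTheory.volume (MahlerCount.unitStarBody d)).toReal * T ^ (d + 1)|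
        ≤ MahlerCount.kappaZero d * T ^ d) ∧
    MahlerCount.kappaZero d
      ≤ 40 * (2 : ℝ) ^ (1 / 4 : ℝ) * Real.pi ^ (3 / 4 : ℝ) * Real.exp (-3)
          * (d : ℝ) ^ (-(1 / 4) : ℝ)
          * (4 * Real.sqrt 2 * Real.exp (3 / 2) * Real.pi ^ (-(3 / 2) : ℝ)) ^ d
          * (2 * Real.sqrt (Real.exp 1)) ^ (d ^ 2) ∧
    40 * (2 : ℝ) ^ (1 / 4 : ℝ) * Real.pi ^ (3 / 4 : ℝ) * Real.exp (-3)
          * (d : ℝ) ^ (-(1 / 4) : ℝ)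
          * (4 * Real.sqrt 2 * Real.exp (3 / 2) * Real.pi ^ (-(3 / 2) : ℝ)) ^ d
          * (2 * Real.sqrt (Real.exp 1)) ^ (d ^ 2)
      ≤ 5.59 * (15.01 : ℝ) ^ (d ^ 2) :=
  -- The unit star body is the sublevel set at `T = 1`.
  ⟨(MahlerCount.intPolys_count d hd le_rfl).2.1,
    fun _ hT => ⟨(MahlerCount.intPolys_count d hd hT).1, (MahlerCount.intPolys_count d hd hT).2.2⟩,
    MahlerCount.kappaZero_le d hd, MahlerCount.explicit_constant_le d hd⟩
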